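/- A parity game $\mathcal{G}$ is a finite directed graph $(V,E)$ in which every vertex has an outgoing edge, with a partition of $V$ into vertices owned by Steven and by Audrey and a priority $\pi(v)\in\mathbb{N}$ for each vertex. For a player $P$, a (positional) $P$-strategy is a set $\sigma\subseteq E$ containing at least one edge out of every vertex owned by $P$ and every edge out of every vertex owned by the opponent; it traps the opponent in $R$ if no edge of $\sigma$ leaves $R$, and a non-empty $R$ is a trap for the opponent if some $P$-strategy does so. A $P$-dominion strategy on $D$ is a $P$-strategy that traps the opponent in $D$ and such that on every cycle of $(D,\sigma)$ the highest priority is even (for $P$ Steven), respectively odd (for $P$ Audrey). A non-empty set with such a strategy is a $P$-dominion; the largest $P$-dominion is the union of all $P$-dominions (possibly empty). The $P$-attractor to $B$ is the largest set $A \supseteq B$ such that for some $P$-strategy $\sigma$ every infinite $\sigma$-path from $A$ visits $B$. All these notions are also used in the subgames induced by sets of vertices. For $d$ even and priorities at most $d$, a Steven $d$-attractor decomposition of $\mathcal{G}$ is $\mathcal{H}=\langle A,(S_1,\mathcal{H}_1,A_1),\dots,(S_\ell,\mathcal{H}_\ell,A_\ell)\rangle$ such that $A$ is the Steven attractor in $\mathcal{G}$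 to the set of vertices of priority $d$ and, with $\mathcal{G}_1=\mathcal{G}\setminus A$, for every $i$: $S_i$ is a non-empty trap for Audrey in $\mathcal{G}_i$ with all priorities at most $d-2$, $\mathcal{H}_i$ is a Steven $(d-2)$-attractor decomposition of $\mathcal{G}\cap S_i$, $A_i$ is the Steven attractor to $S_i$ in $\mathcal{G}_i$, and $\mathcal{G}_{i+1}=\mathcal{G}_i\setminus A_i$; moreover $\mathcal{G}_{\ell+1}$ is empty, and $\ell=0$ if $d=0$. Audrey decompositions are defined dually, with $d$ odd and $\ell=0$ if $d=1$. The tree of $\mathcal{H}$ has as the children of its root the trees of $\mathcal{H}_1,\dots,\mathcal{H}_\ell$. The Strahler number of the one-node tree is $1$; that of a tree whose root has child subtrees $T_1,\dots,T_\ell$ with $\ell\ge1$ and largest Strahler number $m$ is $m$ if exactly one $T_i$ has Strahler number $m$, and $m+1$ otherwise. The Strahler number of $\mathcal{H}$ is that of its tree. The Strahler number of a parity game is the maximum of the smallest Strahler numbers of Steven attractor decompositions of its largest Steven dominion and of Audrey attractor decompositions of its largest Audrey dominion (a minimum over the empty set is $\infty$). Let $d$ be the least even number that is at least every priority of $\mathcal{G}$.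 For $k\ge1$, the $k$-register game $\mathcal{R}^k(\mathcal{G})$ is the parity game with states $(v,\langle r_k,\dots,r_1\rangle)$, owned by Steven and of rank (priority) $1$, and $(v,\langle r_k,\dots,r_1\rangle,p)$, owned by the owner of $v$ and of rank $p$, where $d\ge r_k\ge\dots\ge r_1\ge0$ and $1\le p\le 2k+1$. In $(v,\langle r_k,\dots,r_1\rangle)$ Steven picks $0\le i\le k$ and moves to $(v,\langle r'_k,\dots,r'_{i+1},r'_i,0,\dots,0\rangle,p)$, where $r'_j=\max(r_j,\pi(v))$ for $j>i$, $r'_i=\pi(v)$, and $p=2i$ if $i\ge1$ and $\max(r_i,\pi(v))$ is even, and $p=2i+1$ otherwise. In $(v,\langle r_k,\dots,r_1\rangle,p)$ the owner of $v$ picks an edge $(v,u)\in E$ and moves to $(u,\langle r_k,\dots,r_1\rangle)$. A defensive $k$-register strategy for $D\subseteq V$ is a Steven dominion strategy in $\mathcal{R}^k(\mathcal{G})$ on a set of states that contains no state of rank $2k+1$ and that contains all $(v,\langle r_k,\dots,r_1\rangle)$ such that $v\in D$ and $r_k$ is an even number at least as large as every priority in $D$ (for $D=\emptyset$ the set of states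 may be empty). The Lehtinen number of $\mathcal{G}$ is the smallest $k\ge1$ such that there is a defensive $k$-register strategy for the largest Steven dominion of $\mathcal{G}$ ($\infty$ if there is none). **Lemma.** For every parity game $\mathcal{G}$, the Lehtinen number of $\mathcal{G}$ is at most its Strahler number. Moreover, if a set $D$ of vertices is a trap for Audrey in $\mathcal{G}$ and $\mathcal{H}$ is a Steven attractor decomposition of $\mathcal{G}\cap D$ of Strahler number $k$, then there is a (positional) defensive $k$-register strategy for $D$. -/

import Mathlib

namespace StrahlerGames

universe u

/-- The two players: Steven (also called Even) and Audrey (also called Odd). -/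
inductive Player where
  | steven
  | audrey

/-- Steven likes even priorities, Audrey likes odd priorities. -/
def Player.Likes : Player → ℕ → Prop
  | .steven, n => Even n
  | .audrey, n => Odd n

/-- A parity game with vertex set `V`; every vertex has an outgoing edge.
Finiteness of `V` is assumed separately, by `[Finite V]`. -/
structure ParityGame (V : Type*) where
  edge : V → V → Prop
  owner : V → Player
  priority : V → ℕ
  exists_edge : ∀ v, ∃ u, edge v u

namespace ParityGame

variable {V : Type*}

/-! ### Strategies, traps, dominions

For a set `U` of vertices, the substructure of the game induced by `U` is handled
through notions relative to `U`; the whole game is the case `U = Set.univ`. -/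

/-- `σ` is a (positional) strategy of player `P` in the substructure induced by `U`: a set of
edges containing at least one edge out of every vertex of `P` and all edges out of every vertex
of the opponent. -/
structure IsStrategy (G : ParityGame V) (P : Player) (U : Set V) (σ : V → V → Prop) : Prop where
  sub : ∀ v u, σ v u → v ∈ U ∧ u ∈ U ∧ G.edge v u
  own : ∀ v ∈ U, G.owner v = P → ∃ u, σ v u
  opp : ∀ v ∈ U, G.owner v ≠ P → ∀ u ∈ U, G.edge v u → σ v u

/-- No edge of `σ` leaves `R`. -/
def StaysIn (σ : V → V → Prop) (R : Set V) : Prop :=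
  ∀ w ∈ R, ∀ u, σ w u → u ∈ R

/-- `R` is a trap for the opponent of `P`, in the substructure induced by `U`: it is non-empty
and some strategy of `P` traps the opponent in `R`. -/
def IsTrapForOpponent (G : ParityGame V) (P : Player) (U R : Set V) : Prop :=
  R.Nonempty ∧ R ⊆ U ∧ ∃ σ, G.IsStrategy P U σ ∧ StaysIn σ R

/-- On every cycle `c 0, c 1, …, c n = c 0` of the graph `(D, σ)`, the highest priority
is liked by `P`. -/
def CyclesGoodFor (G : ParityGame V) (P : Player) (D : Set V) (σ : V → V → Prop) : Prop :=
  ∀ (n : ℕ) (c : ℕ → V), 0 < n → c n = c 0 → (∀ i < n, c i ∈ D) →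
    (∀ i < n, σ (c i) (c (i + 1))) →
    ∃ i < n, P.Likes (G.priority (c i)) ∧ ∀ j < n, G.priority (c j) ≤ G.priority (c i)

/-- `σ` is a dominion strategy of `P` on `D`. -/
def IsDominionStrategy (G : ParityGame V) (P : Player) (D : Set V) (σ : V → V → Prop) : Prop :=
  G.IsStrategy P Set.univ σ ∧ StaysIn σ D ∧ G.CyclesGoodFor P D σ

/-- `D` is a dominion of `P`. -/
def IsDominion (G : ParityGame V) (P : Player) (D : Set V) : Prop :=
  D.Nonempty ∧ ∃ σ, G.IsDominionStrategy P D σ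

/-- The largest dominion of `P`: the union of all dominions of `P` (empty if there is none). -/
def largestDominion (G : ParityGame V) (P : Player) : Set V :=
  {v | ∃ D, G.IsDominion P D ∧ v ∈ D}

/-- `σ` is a reachability strategy of `P` to `B` from `A` in the substructure induced by `U`. -/
def IsReachabilityStrategy (G : ParityGame V) (P : Player) (U B A : Set V)
    (σ : V → V → Prop) : Prop :=
  G.IsStrategy P U σ ∧
    ∀ ρ : ℕ → V, ρ 0 ∈ A → (∀ i, σ (ρ i) (ρ (i + 1))) → ∃ i, ρ i ∈ B

/-- `A` is the attractor of `P` to `B` in the substructure induced by `U`: the largest set from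
which `P` has a reachability strategy to `B`. -/
def IsAttractor (G : ParityGame V) (P : Player) (U B A : Set V) : Prop :=
  IsGreatest {A' : Set V | B ⊆ A' ∧ A' ⊆ U ∧ ∃ σ, G.IsReachabilityStrategy P U B A' σ} A

end ParityGame

/-! ### Ordered trees and their Strahler numbers -/

/-- Ordered trees; `node []` is the trivial tree. -/
inductive OrderedTree where
  | node : List OrderedTree → OrderedTree

/-- The Strahler number of a tree from the list of Strahler numbers of the children of its root. -/
def strahlerOfChildren (l : List ℕ) : ℕ :=
  if l = [] then 1
  else if l.count (l.foldr max 0) = 1 then l.foldr max 0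
  else l.foldr max 0 + 1

mutual
/-- The Strahler number of an ordered tree. -/
def OrderedTree.strahler : OrderedTree → ℕ
  | .node ts => strahlerOfChildren (strahlerList ts)
/-- The list of the Strahler numbers of the members of a list of trees. -/
def strahlerList : List OrderedTree → List ℕ
  | [] => []
  | t :: ts => t.strahler :: strahlerList ts
end

/-! ### Attractor decompositions -/

mutual
/-- The data `⟨A, (S₁, H₁, A₁), …, (S_ℓ, H_ℓ, A_ℓ)⟩`. -/
inductive AttrDecomp (V : Type u) where
  | mk (A : Set V) (parts : AttrParts V)
/-- A finite sequence of triples `(S, H, A)`. -/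
inductive AttrParts (V : Type u) where
  | nil
  | cons (S : Set V) (H : AttrDecomp V) (A : Set V) (rest : AttrParts V)
end

mutual
/-- The tree of an attractor decomposition. -/
def AttrDecomp.tree {V : Type u} : AttrDecomp V → OrderedTree
  | .mk _ parts => .node parts.trees
/-- The list of the trees of `H₁, …, H_ℓ`. -/
def AttrParts.trees {V : Type u} : AttrParts V → List OrderedTree
  | .nil => []
  | .cons _ H _ rest => H.tree :: rest.trees
end

/-- The Strahler number of an attractor decomposition is that of its tree. -/
def AttrDecomp.strahler {V : Type*} (H : AttrDecomp V) : ℕ := H.tree.strahler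

namespace ParityGame

variable {V : Type*}

mutual
/-- `H` is a `d`-attractor decomposition for player `P` of the game induced by `U`
(`d` even for Steven, odd for Audrey). -/
def IsAttrDecomp (G : ParityGame V) (P : Player) : ℕ → Set V → AttrDecomp V → Prop
  | d, U, .mk A parts =>
      P.Likes d ∧ (∀ v ∈ U, G.priority v ≤ d) ∧
      G.IsAttractor P U {v | v ∈ U ∧ G.priority v = d} A ∧
      (d < 2 → parts = .nil) ∧
      G.IsAttrParts P d (U \ A) parts
/-- The conditions on the remaining triples, where `U` is the vertex set of the current
game `G_i`; after the last triple this game has to be empty. -/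
def IsAttrParts (G : ParityGame V) (P : Player) : ℕ → Set V → AttrParts V → Prop
  | _, U, .nil => U = ∅
  | d, U, .cons S H A rest =>
      G.IsTrapForOpponent P U S ∧ (∀ v ∈ S, G.priority v + 2 ≤ d) ∧
      G.IsAttrDecomp P (d - 2) S H ∧
      G.IsAttractor P U S A ∧
      G.IsAttrParts P d (U \ A) rest
end

/-- The smallest Strahler number of an attractor decomposition for `P` of the game induced
by `D` (`⊤` if there is none). -/
noncomputable def minStrahler (G : ParityGame V) (P : Player) (D : Set V) : ℕ∞ :=
  sInf {k : ℕ∞ | ∃ (d : ℕ) (H : AttrDecomp V), G.IsAttrDecomp P d D H ∧ k = (H.strahler : ℕ∞)}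

/-- The Strahler number of a parity game. -/
noncomputable def strahlerNumber (G : ParityGame V) : ℕ∞ :=
  max (G.minStrahler .steven (G.largestDominion .steven))
    (G.minStrahler .audrey (G.largestDominion .audrey))

/-! ### Register games -/

/-- The least even number that is at least every priority of the game; it bounds the values of
the registers. -/
noncomputable def evenBound (G : ParityGame V) : ℕ :=
  sInf {d : ℕ | Even d ∧ ∀ v, G.priority v ≤ d}

theorem priority_le_evenBound [Finite V] (G : ParityGame V) (v : V) :
    G.priority v ≤ G.evenBound := by
  have hne : {d : ℕ | Even d ∧ ∀ v, G.priority v ≤ d}.Nonempty := by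
    obtain ⟨M, hM⟩ := (Set.finite_range G.priority).bddAbove
    refine ⟨2 * M, even_two_mul M, fun w => ?_⟩
    have : G.priority w ≤ M := hM ⟨w, rfl⟩
    omega
  exact (Nat.sInf_mem hne).2 v

end ParityGame

/-- Contents `d ≥ r_k ≥ ⋯ ≥ r_1 ≥ 0` of `k` registers; `val j` is the value `r_{j+1}` of
register `j + 1`. -/
structure Registers (k d : ℕ) where
  val : Fin k → ℕ
  mono : Monotone val
  le : ∀ j, val j ≤ d

/-- The contents after resetting the registers `i, …, 1` (none if `i = 0`) at a vertex of
priority `m`. -/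
def Registers.reset {k d : ℕ} (r : Registers k d) (m : ℕ) (hm : m ≤ d) (i : Fin (k + 1)) :
    Registers k d where
  val j := if (i : ℕ) < j + 1 then max (r.val j) m else if (j : ℕ) + 1 = i then m else 0
  mono := by
    intro a b hab
    have h1 : r.val a ≤ r.val b := r.mono hab
    have h2 : (a : ℕ) ≤ b := hab
    dsimp only
    split_ifs <;> omega
  le := by
    intro j
    have h1 := r.le j
    split_ifs <;> omega

/-- The rank produced by resetting the registers `i, …, 1` at a vertex of priority `m`. -/
def Registers.resetRank {k d : ℕ} (r : Registers k d) (m : ℕ) (i : Fin (k + 1)) : ℕ :=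
  Fin.cases 1
    (fun j : Fin k => if Even (max (r.val j) m) then 2 * ((j : ℕ) + 1) else 2 * ((j : ℕ) + 1) + 1) i

theorem Registers.resetRank_mem {k d : ℕ} (r : Registers k d) (m : ℕ) (i : Fin (k + 1)) :
    r.resetRank m i ∈ Set.Icc 1 (2 * k + 1) := by
  induction i using Fin.cases with
  | zero => simp [Registers.resetRank]
  | succ j =>
    have := j.isLt
    simp only [Registers.resetRank, Fin.cases_succ, Set.mem_Icc]
    split_ifs <;> omega

/-- States of the `k`-register game: pairs `(v, r)` and triples `(v, r, p)`. -/
inductive RegState (V : Type*) (k d : ℕ) where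
  | pair (v : V) (r : Registers k d)
  | triple (v : V) (r : Registers k d) (p : Set.Icc 1 (2 * k + 1))

namespace ParityGame

variable {V : Type*}

/-- The moves of the Steven `k`-register game. -/
inductive RegMove [Finite V] (G : ParityGame V) (k : ℕ) :
    RegState V k G.evenBound → RegState V k G.evenBound → Prop where
  | reset (v : V) (r : Registers k G.evenBound) (i : Fin (k + 1)) :
      RegMove G k (.pair v r)
        (.triple v (r.reset (G.priority v) (G.priority_le_evenBound v) i)
          ⟨r.resetRank (G.priority v) i, r.resetRank_mem (G.priority v) i⟩)
  | move (v u : V) (r : Registers k G.evenBound) (p : Set.Icc 1 (2 * k + 1)) (h : G.edge v u) :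
      RegMove G k (.triple v r p) (.pair u r)

/-- The Steven `k`-register game on `G`, itself a parity game; its priorities are the ranks. -/
def regGame [Finite V] (G : ParityGame V) (k : ℕ) : ParityGame (RegState V k G.evenBound) where
  edge := G.RegMove k
  owner
    | .pair _ _ => .steven
    | .triple v _ _ => G.owner v
  priority
    | .pair _ _ => 1
    | .triple _ _ p => p
  exists_edge := by
    rintro (⟨v, r⟩ | ⟨v, r, p⟩)
    · exact ⟨_, .reset v r 0⟩
    · obtain ⟨u, hu⟩ := G.exists_edge v
      exact ⟨_, .move v u r p hu⟩

/-- Steven has a defensive dominion strategy in the `k`-register game on a set `Ω` of states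
that includes all `(v, ⟨r_k, …, r_1⟩)` such that `v ∈ D` and `r_k` is an even number at least as
large as every priority in `D`. (If `D` is non-empty then so is `Ω`, since the largest value
allowed for the registers is even.) -/
def HasDefensiveStrategy [Finite V] (G : ParityGame V) (k : ℕ) (D : Set V) : Prop :=
  ∃ (Ω : Set (RegState V k G.evenBound))
    (σ : RegState V k G.evenBound → RegState V k G.evenBound → Prop),
    (G.regGame k).IsDominionStrategy .steven Ω σ ∧
    (∀ s ∈ Ω, (G.regGame k).priority s ≠ 2 * k + 1) ∧
    ∀ v ∈ D, ∀ r : Registers k G.evenBound,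
      (∀ j : Fin k, (j : ℕ) + 1 = k → Even (r.val j) ∧ ∀ w ∈ D, G.priority w ≤ r.val j) →
      .pair v r ∈ Ω

/-- The Lehtinen number (defensive register number) of a Steven dominion `D`: the smallest
positive `k` with a defensive strategy as above (`⊤` if there is none). -/
noncomputable def lehtinenNumberOn [Finite V] (G : ParityGame V) (D : Set V) : ℕ∞ :=
  sInf {m : ℕ∞ | ∃ k : ℕ, 0 < k ∧ G.HasDefensiveStrategy k D ∧ m = (k : ℕ∞)}

/-- The Lehtinen number of a parity game. -/
noncomputable def lehtinenNumber [Finite V] (G : ParityGame V) : ℕ∞ :=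
  G.lehtinenNumberOn (G.largestDominion .steven)

end ParityGame

end StrahlerGames

-- Steven's strategy depends only on the vertex: `f v` is his move and `ρ v` the number of registers
-- he resets. Induction on the decomposition gives it two properties. `RegStrategy`: every play is
-- won from arbitrary register contents, so only the tail of a play matters. `IsInvariant`: a
-- condition on the vertex and the top register, preserved by moves, which excludes an odd outcome
-- of resetting all `k` registers, the only source of the rank `2 * k + 1`.
--
-- All registers are reset at vertices of the highest priority `d`, and none on the rest of their
-- attractor (`RegStrategy.attract`). If `d` recurs, the invariant holds after the first visit, so
-- from then on every visit produces `2 * k` and no larger rank occurs. Otherwise the play ends up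
-- outside the attractor.
--
-- There, a play that enters `A_i` and remains in the current game `G_i` reaches `S_i` and stays in
-- it (`RegStrategy.cons`). As the Strahler number is at most `k`, at most one `S_i` needs all `k`
-- registers; the others manage with `k - 1` and never reset the top one. Hence a play reaching the
-- exceptional `S_i` from later triples still has its even initial top value, a bound for all
-- priorities, and the invariant of `S_i` can start (`IsInvariant.cons_eq`). In earlier triples it
-- is enough that the top register holds no odd number above `d` (`IsInvariant.cons_lt`).
--
-- The strategy is then lifted to the states of the register game, where a cycle repeated forever is
-- a play.

namespace StrahlerGames

universe u

/-! ### Plays with registers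

The contents of the registers are functions `r : ℕ → ℕ`, of which the strategies with `k`
registers use the values at `0, …, k - 1`. -/

/-- The contents of the register `j` after a reset of the first `i` registers at a vertex of
priority `m`. -/
def regUpdate (r : ℕ → ℕ) (m i j : ℕ) : ℕ :=
  if i < j + 1 then max (r j) m else if j + 1 = i then m else 0

/-- The rank produced by a reset of the first `i` registers at a vertex of priority `m`. -/
def regRank (r : ℕ → ℕ) (m i : ℕ) : ℕ :=
  if i = 0 then 1 else if Even (max (r (i - 1)) m) then 2 * i else 2 * i + 1

theorem one_le_regRank (r : ℕ → ℕ) (m i : ℕ) : 1 ≤ regRank r m i := by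
  unfold regRank
  split_ifs <;> omega

/-- The largest number that occurs infinitely often in `p` exists and is even. -/
def ParityWins (p : ℕ → ℕ) : Prop :=
  ∃ e, Even e ∧ (∀ N, ∃ t ≥ N, p t = e) ∧ ∃ N, ∀ t ≥ N, p t ≤ e

theorem ParityWins.of_shift {p : ℕ → ℕ} (s : ℕ) (h : ParityWins fun t => p (t + s)) :
    ParityWins p := by
  obtain ⟨e, he, hf, N, hN⟩ := h
  refine ⟨e, he, fun M => ?_, N + s, fun t ht => ?_⟩
  · obtain ⟨t, ht, hp⟩ := hf M
    exact ⟨t + s, by omega, hp⟩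
  · simpa [Nat.sub_add_cancel (show s ≤ t by omega)] using hN (t - s) (by omega)

namespace ParityGame

variable {V : Type*}

/-- A move inside `U` in which Steven follows `f`. -/
structure Step (G : ParityGame V) (U : Set V) (f : V → V) (v u : V) : Prop where
  source : v ∈ U
  target : u ∈ U
  edge : G.edge v u
  own : G.owner v = .steven → u = f v

theorem Step.restrict {G : ParityGame V} {U S : Set V} {f g : V → V} {v u : V}
    (h : G.Step U f v u) (hv : v ∈ S) (hu : u ∈ S) (hfg : f v = g v) : G.Step S g v u :=
  ⟨hv, hu, h.edge, fun ho => hfg ▸ h.own ho⟩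

/-- A play inside `U` in which Steven moves by `f` and resets the registers given by `ρ`,
with the contents of the first `k` registers. -/
structure IsRegPlay (G : ParityGame V) (k : ℕ) (U : Set V) (f : V → V) (ρ : V → ℕ)
    (v : ℕ → V) (r : ℕ → ℕ → ℕ) : Prop where
  step : ∀ t, G.Step U f (v t) (v (t + 1))
  update : ∀ t, ∀ j < k, r (t + 1) j = regUpdate (r t) (G.priority (v t)) (ρ (v t)) j

/-- Steven wins all plays inside `U`, whatever the initial contents of the registers. -/
structure RegStrategy (G : ParityGame V) (k : ℕ) (U : Set V) (f : V → V) (ρ : V → ℕ) : Prop where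
  own : ∀ v ∈ U, G.owner v = .steven → f v ∈ U ∧ G.edge v (f v)
  le : ∀ v ∈ U, ρ v ≤ k
  wins : ∀ v r, G.IsRegPlay k U f ρ v r →
    ParityWins fun t => regRank (r t) (G.priority (v t)) (ρ (v t))

/-- Registers evolve independently of each other, so the lowest `k` of `l` registers form a play by
themselves. -/
theorem RegStrategy.mono {G : ParityGame V} {k l : ℕ} {U : Set V} {f : V → V} {ρ : V → ℕ}
    (h : G.RegStrategy k U f ρ) (hkl : k ≤ l) : G.RegStrategy l U f ρ where
  own := h.own
  le v hv := (h.le v hv).trans hkl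
  wins v r hp := h.wins v r ⟨hp.step, fun t j hj => hp.update t j (by omega)⟩

/-- A tail of a play is a play with other initial registers, and winning does not depend on these.
-/
theorem RegStrategy.wins_of_eventually {G : ParityGame V} {k : ℕ} {U S : Set V} {f g : V → V}
    {ρ ρ' : V → ℕ} (h : G.RegStrategy k S g ρ') (hfg : ∀ v ∈ S, f v = g v ∧ ρ v = ρ' v)
    {v : ℕ → V} {r : ℕ → ℕ → ℕ} (hp : G.IsRegPlay k U f ρ v r) (N : ℕ)
    (hN : ∀ t ≥ N, v t ∈ S) :
    ParityWins fun t => regRank (r t) (G.priority (v t)) (ρ (v t)) := by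
  apply ParityWins.of_shift N
  have hS : ∀ t, v (t + N) ∈ S := fun t => hN _ (by omega)
  have key := h.wins (fun t => v (t + N)) (fun t => r (t + N))
    { step := fun t => by
        have h2 := hS (t + 1)
        have h3 := hp.step (t + N)
        rw [show t + 1 + N = t + N + 1 by omega] at *
        exact h3.restrict (hS t) h2 (hfg _ (hS t)).1
      update := fun t j hj => by
        rw [show t + 1 + N = t + N + 1 by omega, ← (hfg _ (hS t)).2]
        exact hp.update (t + N) j hj }
  simpa only [← (hfg _ (hS _)).2] using key

/-- A property of the vertex and the contents of the highest register that ensures that the rank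
`2 * k + 1` does not occur. -/
structure IsInvariant (G : ParityGame V) (k d : ℕ) (U : Set V) (f : V → V) (ρ : V → ℕ)
    (I : V → ℕ → Prop) : Prop where
  even : ∀ v x, I v x → Even (max x d)
  step : ∀ v x u, I v x → G.Step U f v u →
    I u (if ρ v = k then G.priority v else max x (G.priority v))
  safe : ∀ v x, I v x → ρ v = k → Even (max x (G.priority v))

theorem regUpdate_top {k i : ℕ} (hk : 1 ≤ k) (hi : i ≤ k) (r : ℕ → ℕ) (m : ℕ) :
    regUpdate r m i (k - 1) = if i = k then m else max (r (k - 1)) m := by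
  unfold regUpdate
  by_cases h : i = k
  · rw [if_neg (show ¬ i < k - 1 + 1 by omega), if_pos (show k - 1 + 1 = i by omega), if_pos h]
  · rw [if_pos (show i < k - 1 + 1 by omega), if_neg h]

theorem IsInvariant.regRank_le {G : ParityGame V} {k d : ℕ} {U : Set V} {f : V → V} {ρ : V → ℕ}
    {I : V → ℕ → Prop} (h : G.IsInvariant k d U f ρ I) {v : V} {r : ℕ → ℕ}
    (hk : 1 ≤ k) (hv : ρ v ≤ k) (hI : I v (r (k - 1))) :
    regRank r (G.priority v) (ρ v) ≤ 2 * k := by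
  unfold regRank
  rcases hv.lt_or_eq with hlt | heq
  · split_ifs <;> omega
  · have := h.safe _ _ hI heq
    rw [heq, if_pos this]
    split_ifs <;> omega

/-! ### Attractors -/

/-- Closure comes from maximality: a successor `u` of a vertex of `A` outside `B` could be added to
`A`. -/
theorem IsAttractor.exists_step {G : ParityGame V} {U B A : Set V}
    (h : G.IsAttractor .steven U B A) :
    ∃ f : V → V, (∀ v ∈ U, G.owner v = .steven → f v ∈ U ∧ G.edge v (f v)) ∧
      (∀ v u, v ∈ A → v ∉ B → G.Step U f v u → u ∈ A) ∧
      ∀ w : ℕ → V, (∀ t, G.Step U f (w t) (w (t + 1))) → w 0 ∈ A → ∃ t, w t ∈ B := by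
  classical
  obtain ⟨⟨hBA, hAU, τ, hτ, hreach⟩, hmax⟩ := h
  have hch : ∀ v, ∃ u, v ∈ U → G.owner v = .steven → τ v u := fun v => by
    by_cases hv : v ∈ U ∧ G.owner v = .steven
    · obtain ⟨u, hu⟩ := hτ.own v hv.1 hv.2
      exact ⟨u, fun _ _ => hu⟩
    · exact ⟨v, fun h1 h2 => absurd ⟨h1, h2⟩ hv⟩
  choose f hf using hch
  have hstep : ∀ v u, G.Step U f v u → τ v u := fun v u hs => by
    by_cases ho : G.owner v = .steven
    · rw [hs.own ho]
      exact hf v hs.source ho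
    · exact hτ.opp v hs.source ho u hs.target hs.edge
  refine ⟨f, fun v hv ho => (hτ.sub _ _ (hf v hv ho)).2, fun v u hvA hvB hs => ?_,
    fun w hw h0 => hreach w h0 fun t => hstep _ _ (hw t)⟩
  have hmem : insert u A ∈ {A' : Set V | B ⊆ A' ∧ A' ⊆ U ∧
      ∃ σ, G.IsReachabilityStrategy .steven U B A' σ} := by
    refine ⟨hBA.trans (Set.subset_insert _ _), Set.insert_subset hs.target hAU, τ, hτ, ?_⟩
    intro w h0 hw
    -- A play from `u`, preceded by `v`, is a play from `A`; it visits `B`, and not at `v`.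
    rcases h0 with h0 | h0
    · obtain ⟨i, hi⟩ := hreach (fun t => if t = 0 then v else w (t - 1)) (by simpa using hvA)
        (fun i => by
          rcases i with _ | i
          · simpa [h0] using hstep _ _ hs
          · simpa using hw i)
      rcases i with _ | i
      · exact absurd (by simpa using hi) hvB
      · exact ⟨i, by simpa using hi⟩
    · exact hreach w h0 hw
  exact hmax hmem (Set.mem_insert _ _)

theorem IsTrapForOpponent.mem_of_edge {G : ParityGame V} {U S : Set V}
    (h : G.IsTrapForOpponent .steven U S) {v u : V} (hv : v ∈ S) (ho : G.owner v ≠ .steven)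
    (hu : u ∈ U) (he : G.edge v u) : u ∈ S := by
  obtain ⟨-, hSU, σ, hσ, hst⟩ := h
  exact hst v hv u (hσ.opp v (hSU hv) ho u hu he)

/-! ### Composition of strategies -/

/-- `S` and `A` cannot be left inside `U`, so a play either avoids `A` forever or settles in `S`:
staying in `A` outside `S` would contradict the attractor strategy. -/
theorem RegStrategy.cons {G : ParityGame V} {k : ℕ} {U S A : Set V} {f₁ f₂ : V → V}
    {ρ₁ ρ₂ : V → ℕ} (hS : G.IsTrapForOpponent .steven U S) (hA : G.IsAttractor .steven U S A)
    (h₁ : G.RegStrategy k S f₁ ρ₁) (h₂ : G.RegStrategy k (U \ A) f₂ ρ₂) :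
    ∃ f ρ, G.RegStrategy k U f ρ ∧ (∀ v ∈ S, f v = f₁ v ∧ ρ v = ρ₁ v) ∧
      (∀ v ∈ U \ A, f v = f₂ v ∧ ρ v = ρ₂ v) ∧ (∀ v ∈ A, v ∉ S → ρ v = 0) ∧
      (∀ v u, v ∈ S → G.Step U f v u → u ∈ S) ∧ (∀ v u, v ∈ A → G.Step U f v u → u ∈ A) := by
  classical
  have hSA : S ⊆ A := hA.1.1
  have hAU : A ⊆ U := hA.1.2.1
  obtain ⟨g, hg, hgA, hgr⟩ := hA.exists_step
  let f : V → V := fun v => if v ∈ S then f₁ v else if v ∈ A then g v else f₂ v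
  let ρ : V → ℕ := fun v => if v ∈ S then ρ₁ v else if v ∈ A then 0 else ρ₂ v
  have e₁ : ∀ v ∈ S, f v = f₁ v ∧ ρ v = ρ₁ v := fun v hv => ⟨if_pos hv, if_pos hv⟩
  have e₂ : ∀ v ∈ U \ A, f v = f₂ v ∧ ρ v = ρ₂ v := fun v hv => by
    have hvS : v ∉ S := fun h => hv.2 (hSA h)
    exact ⟨(if_neg hvS).trans (if_neg hv.2), (if_neg hvS).trans (if_neg hv.2)⟩
  have e₃ : ∀ v ∈ A, v ∉ S → f v = g v ∧ ρ v = 0 := fun v hv hvS =>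
    ⟨(if_neg hvS).trans (if_pos hv), (if_neg hvS).trans (if_pos hv)⟩
  have cS : ∀ v u, v ∈ S → G.Step U f v u → u ∈ S := fun v u hv hs => by
    by_cases ho : G.owner v = .steven
    · rw [hs.own ho, (e₁ v hv).1]
      exact (h₁.own v hv ho).1
    · exact hS.mem_of_edge hv ho hs.target hs.edge
  have cA : ∀ v u, v ∈ A → G.Step U f v u → u ∈ A := fun v u hv hs => by
    by_cases hvS : v ∈ S
    · exact hSA (cS v u hvS hs)
    · exact hgA v u hv hvS (hs.restrict hs.source hs.target (e₃ v hv hvS).1)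
  refine ⟨f, ρ, ⟨fun v hv ho => ?_, fun v hv => ?_, fun v r hp => ?_⟩, e₁, e₂,
    fun v hv hvS => (e₃ v hv hvS).2, cS, cA⟩
  · by_cases hvS : v ∈ S
    · rw [(e₁ v hvS).1]
      exact ⟨hAU (hSA (h₁.own v hvS ho).1), (h₁.own v hvS ho).2⟩
    · by_cases hvA : v ∈ A
      · rw [(e₃ v hvA hvS).1]
        exact hg v hv ho
      · rw [(e₂ v ⟨hv, hvA⟩).1]
        exact ⟨(h₂.own v ⟨hv, hvA⟩ ho).1.1, (h₂.own v ⟨hv, hvA⟩ ho).2⟩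
  · by_cases hvS : v ∈ S
    · rw [(e₁ v hvS).2]
      exact h₁.le v hvS
    · by_cases hvA : v ∈ A
      · rw [(e₃ v hvA hvS).2]
        exact Nat.zero_le _
      · rw [(e₂ v ⟨hv, hvA⟩).2]
        exact h₂.le v ⟨hv, hvA⟩
  · by_cases hex : ∃ t, v t ∈ A
    · obtain ⟨t₀, ht₀⟩ := hex
      have hstay : ∀ t ≥ t₀, v t ∈ A := fun t ht => by
        induction t, ht using Nat.le_induction with
        | base => exact ht₀
        | succ t _ ih => exact cA _ _ ih (hp.step t)
      have hS' : ∃ t₁, v t₁ ∈ S := by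
        by_contra! hno
        obtain ⟨t, ht⟩ := hgr (fun t => v (t + t₀)) (fun t => by
          have := hp.step (t + t₀)
          rw [show t + 1 + t₀ = t + t₀ + 1 by omega]
          exact this.restrict this.source this.target
            (e₃ _ (hstay _ (by omega)) (hno _)).1) (by simpa using ht₀)
        exact hno _ ht
      obtain ⟨t₁, ht₁⟩ := hS'
      refine h₁.wins_of_eventually e₁ hp t₁ fun t ht => ?_
      induction t, ht using Nat.le_induction with
      | base => exact ht₁
      | succ t _ ih => exact cS _ _ ih (hp.step t)
    · push Not at hex
      exact h₂.wins_of_eventually e₂ hp 0 fun t _ => ⟨(hp.step t).source, hex t⟩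

theorem even_max {a b : ℕ} (ha : Even a) (hb : Even b) : Even (max a b) := by
  rcases max_choice a b with h | h <;> rwa [h]

/-- The hypothesis says that `x` is not an odd number above `a` (and that `a` is even if it exceeds
`x`); the condition weakens as the bound grows. -/
theorem even_max_of_le {x a b : ℕ} (h : Even (max x a)) (hb : Even b) (hab : a ≤ b) :
    Even (max x b) := by
  rcases le_total x b with hx | hx
  · rwa [max_eq_right hx]
  · rwa [max_eq_left hx, ← max_eq_left (hab.trans hx)]

theorem even_max_max_of_le {x m d : ℕ} (h : Even (max x d)) (hm : m ≤ d) :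
    Even (max (max x m) d) := by
  rwa [max_assoc, max_eq_right hm]

/-- The strategy on a game from the strategy outside the attractor to the vertices of the highest
priority `d`. -/
theorem RegStrategy.attract {G : ParityGame V} {k d : ℕ} {U A : Set V} {f₂ : V → V}
    {ρ₂ : V → ℕ} {I₂ : V → ℕ → Prop} (hk : 1 ≤ k) (hd : Even d) (hU : ∀ v ∈ U, G.priority v ≤ d)
    (hA : G.IsAttractor .steven U {v | v ∈ U ∧ G.priority v = d} A)
    (h₂ : G.RegStrategy k (U \ A) f₂ ρ₂) (hI₂ : G.IsInvariant k d (U \ A) f₂ ρ₂ I₂)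
    (hI₂' : ∀ v ∈ U \ A, ∀ x, Even x → (∀ w ∈ U, G.priority w ≤ x) → I₂ v x) :
    ∃ f ρ I, G.RegStrategy k U f ρ ∧ G.IsInvariant k d U f ρ I ∧
      ∀ v ∈ U, ∀ x, Even x → (∀ w ∈ U, G.priority w ≤ x) → I v x := by
  classical
  have hBA := hA.1.1
  have hAU : A ⊆ U := hA.1.2.1
  obtain ⟨g, hg, hgA, hgr⟩ := hA.exists_step
  set B : Set V := {v | v ∈ U ∧ G.priority v = d} with hB
  let f : V → V := fun v => if v ∈ A then g v else f₂ v
  let ρ : V → ℕ := fun v => if v ∈ B then k else if v ∈ A then 0 else ρ₂ v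
  let I : V → ℕ → Prop := fun v x => v ∈ U ∧ if v ∈ A then Even (max x d) else I₂ v x
  have fA : ∀ v ∈ A, f v = g v := fun v hv => if_pos hv
  have ρB : ∀ v ∈ B, ρ v = k := fun v hv => if_pos hv
  have ρA : ∀ v ∈ A, v ∉ B → ρ v = 0 := fun v hv hvB => (if_neg hvB).trans (if_pos hv)
  have e₂ : ∀ v ∈ U \ A, f v = f₂ v ∧ ρ v = ρ₂ v := fun v hv => by
    have hvB : v ∉ B := fun h => hv.2 (hBA h)
    exact ⟨if_neg hv.2, (if_neg hvB).trans (if_neg hv.2)⟩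
  have hle : ∀ v ∈ U, ρ v ≤ k := fun v hv => by
    by_cases hvB : v ∈ B
    · exact (ρB v hvB).le
    · by_cases hvA : v ∈ A
      · rw [ρA v hvA hvB]
        exact Nat.zero_le _
      · rw [(e₂ v ⟨hv, hvA⟩).2]
        exact h₂.le v ⟨hv, hvA⟩
  have hstart : ∀ v ∈ U, ∀ x, Even x → (∀ w ∈ U, G.priority w ≤ x) → I v x := by
    intro v hv x hx hxU
    refine ⟨hv, ?_⟩
    split_ifs with hvA
    · exact even_max hx hd
    · exact hI₂' v ⟨hv, hvA⟩ x hx hxU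
  have hIe : ∀ v x, I v x → Even (max x d) := by
    rintro v x ⟨hv, hI⟩
    split_ifs at hI with hvA
    · exact hI
    · exact hI₂.even v x hI
  have hinv : G.IsInvariant k d U f ρ I := by
    refine ⟨hIe, fun v x u hI hs => ?_, fun v x hI hρ => ?_⟩
    -- At priority `d` the top register becomes `d`, an even bound for all priorities in `U`, so the
    -- invariant starts afresh.
    · by_cases hvB : v ∈ B
      · rw [if_pos (ρB v hvB), hvB.2]
        exact hstart u hs.target d hd hU
      have hx' : Even (max (if ρ v = k then G.priority v else max x (G.priority v)) d) := by
        split_ifs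
        · rwa [max_eq_right (hU v hs.source)]
        · exact even_max_max_of_le (hIe v x hI) (hU v hs.source)
      refine ⟨hs.target, ?_⟩
      by_cases huA : u ∈ A
      · rwa [if_pos huA]
      · rw [if_neg huA]
        have hvA : v ∉ A := fun hvA => huA (hgA v u hvA hvB
          (hs.restrict hs.source hs.target (fA v hvA)))
        have hv : v ∈ U \ A := ⟨hs.source, hvA⟩
        have hI' := hI.2
        rw [if_neg hvA] at hI'
        rw [(e₂ v hv).2]
        exact hI₂.step v x u hI' (hs.restrict hv ⟨hs.target, huA⟩ (e₂ v hv).1)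
    · by_cases hvB : v ∈ B
      · rw [hvB.2]
        exact hIe v x hI
      · have hvA : v ∉ A := fun hvA => by
          have := ρA v hvA hvB
          omega
        have hI' := hI.2
        rw [if_neg hvA] at hI'
        exact hI₂.safe v x hI' ((e₂ v ⟨hI.1, hvA⟩).2 ▸ hρ)
  refine ⟨f, ρ, I, ⟨fun v hv ho => ?_, hle, fun v r hp => ?_⟩, hinv, hstart⟩
  · by_cases hvA : v ∈ A
    · rw [fA v hvA]
      exact hg v hv ho
    · rw [(e₂ v ⟨hv, hvA⟩).1]
      exact ⟨(h₂.own v ⟨hv, hvA⟩ ho).1.1, (h₂.own v ⟨hv, hvA⟩ ho).2⟩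
  · by_cases hinf : ∀ N, ∃ t ≥ N, v t ∈ B
    · obtain ⟨t₀, -, ht₀⟩ := hinf 0
      -- The initial contents are arbitrary, so the invariant is only available after the first
      -- visit to `B`.
      have hIt : ∀ t ≥ t₀ + 1, I (v t) (r t (k - 1)) := fun t ht => by
        induction t, ht using Nat.le_induction with
        | base =>
          rw [hp.update t₀ (k - 1) (by omega), regUpdate_top hk (hle _ (hp.step t₀).source),
            if_pos (ρB _ ht₀), ht₀.2]
          exact hstart _ (hp.step t₀).target d hd hU
        | succ t _ ih =>
          rw [hp.update t (k - 1) (by omega), regUpdate_top hk (hle _ (hp.step t).source)]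
          exact hinv.step _ _ _ ih (hp.step t)
      refine ⟨2 * k, even_two_mul k, fun N => ?_, t₀ + 1, fun t ht =>
        hinv.regRank_le hk (hle _ (hp.step t).source) (hIt t ht)⟩
      obtain ⟨t, ht, htB⟩ := hinf (max N (t₀ + 1))
      have hI := hIt t (le_of_max_le_right ht)
      refine ⟨t, le_of_max_le_left ht, ?_⟩
      simp only [regRank, ρB _ htB]
      rw [if_neg (by omega), if_pos (hinv.safe _ _ hI (ρB _ htB))]
    · push Not at hinf
      obtain ⟨N, hN⟩ := hinf
      -- After the last visit to `B` the play cannot be in `A`, as the attractor strategy would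
      -- force another visit.
      refine h₂.wins_of_eventually e₂ hp N fun t ht => ⟨(hp.step t).source, fun htA => ?_⟩
      have hstay : ∀ s, v (s + t) ∈ A := fun s => by
        induction s with
        | zero => simpa using htA
        | succ s ih =>
          have hs := hp.step (s + t)
          rw [show s + 1 + t = s + t + 1 by omega]
          exact hgA _ _ ih (hN _ (by omega)) (hs.restrict hs.source hs.target (fA _ ih))
      obtain ⟨s, hs⟩ := hgr (fun s => v (s + t)) (fun s => by
        have hs := hp.step (s + t)
        rw [show s + 1 + t = s + t + 1 by omega]
        exact hs.restrict hs.source hs.target (fA _ (hstay s))) (hstay 0)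
      exact hN _ (by omega) hs

end ParityGame

/-! ### Strahler numbers -/

/-- Two children with the Strahler number `k` would force the parent above `k`. -/
theorem strahlerOfChildren_le {l : List ℕ} {k : ℕ} (h : strahlerOfChildren l ≤ k)
    (hl : ∀ x ∈ l, 1 ≤ x) : 1 ≤ k ∧ (∀ x ∈ l, x ≤ k) ∧ l.count k ≤ 1 := by
  have hmax : ∀ x ∈ l, x ≤ l.foldr max 0 := fun x hx => List.le_max_of_le' 0 hx le_rfl
  unfold strahlerOfChildren at h
  split_ifs at h with h1 h2
  · subst h1
    simpa using h
  · obtain ⟨x, hx⟩ := List.exists_mem_of_ne_nil l h1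
    refine ⟨(hl x hx).trans ((hmax x hx).trans h), fun x hx => (hmax x hx).trans h, ?_⟩
    rcases h.lt_or_eq with hlt | heq
    · rw [List.count_eq_zero_of_not_mem fun hk => by have := hmax k hk; omega]
      exact zero_le_one
    · rw [← heq, h2]
  · refine ⟨by omega, fun x hx => (hmax x hx).trans (by omega), ?_⟩
    rw [List.count_eq_zero_of_not_mem fun hk => by have := hmax k hk; omega]
    exact zero_le_one

mutual
theorem OrderedTree.one_le_strahler : ∀ T : OrderedTree, 1 ≤ T.strahler
  | .node ts => by
    rw [OrderedTree.strahler]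
    have h := one_le_of_mem_strahlerList ts
    exact (strahlerOfChildren_le le_rfl h).1
theorem one_le_of_mem_strahlerList : ∀ ts : List OrderedTree, ∀ x ∈ strahlerList ts, 1 ≤ x
  | [] => by simp [strahlerList]
  | t :: ts => by
    have h1 := t.one_le_strahler
    have h2 := one_le_of_mem_strahlerList ts
    simpa [strahlerList, h1] using h2
end

-- Induction on the attractor decomposition

namespace ParityGame

variable {V : Type u}

/-- Composition along a triple `(S, H, A)` whose part `S` needs fewer than `k` registers. -/
theorem IsInvariant.cons_lt {G : ParityGame V} {k d : ℕ} {U S A D : Set V} {f₁ f₂ : V → V}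
    {ρ₁ ρ₂ : V → ℕ} {I₂ : V → ℕ → Prop} (hk : 1 ≤ k) (hd : Even d)
    (hU : ∀ v ∈ U, G.priority v ≤ d) (hS : G.IsTrapForOpponent .steven U S)
    (hA : G.IsAttractor .steven U S A) (h₁ : G.RegStrategy (k - 1) S f₁ ρ₁)
    (h₂ : G.RegStrategy k (U \ A) f₂ ρ₂) (hI₂ : G.IsInvariant k d (U \ A) f₂ ρ₂ I₂)
    (hI₂' : ∀ v ∈ U \ A, ∀ x, Even x → (∀ w ∈ D, G.priority w ≤ x) → I₂ v x) :
    ∃ f ρ I, G.RegStrategy k U f ρ ∧ G.IsInvariant k d U f ρ I ∧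
      ∀ v ∈ U, ∀ x, Even x → (∀ w ∈ D, G.priority w ≤ x) → I v x := by
  classical
  obtain ⟨f, ρ, hf, e₁, e₂, e₃, cS, cA⟩ := RegStrategy.cons hS hA (h₁.mono (Nat.sub_le k 1)) h₂
  have hρA : ∀ v ∈ A, ρ v ≠ k := fun v hv => by
    by_cases hvS : v ∈ S
    · have := h₁.le v hvS
      rw [(e₁ v hvS).2]
      omega
    · rw [e₃ v hv hvS]
      omega
  -- On `A`, which is never left, the top register is never reset; only odd values above `d` have to
  -- be excluded.
  let I : V → ℕ → Prop := fun v x => v ∈ U ∧ if v ∈ A then Even (max x d) else I₂ v x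
  have hIe : ∀ v x, I v x → Even (max x d) := by
    rintro v x ⟨hv, hI⟩
    split_ifs at hI with hvA
    · exact hI
    · exact hI₂.even v x hI
  refine ⟨f, ρ, I, hf, ⟨hIe, fun v x u hI hs => ⟨hs.target, ?_⟩, fun v x hI hρ => ?_⟩, ?_⟩
  · by_cases huA : u ∈ A
    · rw [if_pos huA]
      split_ifs
      · rwa [max_eq_right (hU v hs.source)]
      · exact even_max_max_of_le (hIe v x hI) (hU v hs.source)
    · rw [if_neg huA]
      have hvA : v ∉ A := fun hvA => huA (cA v u hvA hs)
      have hv : v ∈ U \ A := ⟨hs.source, hvA⟩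
      have hI' := hI.2
      rw [if_neg hvA] at hI'
      rw [(e₂ v hv).2]
      exact hI₂.step v x u hI' (hs.restrict hv ⟨hs.target, huA⟩ (e₂ v hv).1)
  · have hvA : v ∉ A := fun hvA => hρA v hvA hρ
    have hI' := hI.2
    rw [if_neg hvA] at hI'
    exact hI₂.safe v x hI' ((e₂ v ⟨hI.1, hvA⟩).2 ▸ hρ)
  · intro v hv x hx hxD
    refine ⟨hv, ?_⟩
    split_ifs with hvA
    · exact even_max hx hd
    · exact hI₂' v ⟨hv, hvA⟩ x hx hxD

/-- Composition along a triple `(S, H, A)` whose part `S` uses all `k` registers. -/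
theorem IsInvariant.cons_eq {G : ParityGame V} {k d c : ℕ} {U S A D : Set V} {f₁ f₂ : V → V}
    {ρ₁ ρ₂ : V → ℕ} {I₁ : V → ℕ → Prop} (hk : 1 ≤ k) (hd : Even d) (hcd : c ≤ d) (hUD : U ⊆ D)
    (hS : G.IsTrapForOpponent .steven U S)
    (hA : G.IsAttractor .steven U S A) (h₁ : G.RegStrategy k S f₁ ρ₁)
    (hI₁ : G.IsInvariant k c S f₁ ρ₁ I₁)
    (hI₁' : ∀ v ∈ S, ∀ x, Even x → (∀ w ∈ S, G.priority w ≤ x) → I₁ v x)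
    (h₂ : G.RegStrategy (k - 1) (U \ A) f₂ ρ₂) :
    ∃ f ρ I, G.RegStrategy k U f ρ ∧ G.IsInvariant k d U f ρ I ∧
      ∀ v ∈ U, ∀ x, Even x → (∀ w ∈ D, G.priority w ≤ x) → I v x := by
  classical
  obtain ⟨f, ρ, hf, e₁, e₂, e₃, cS, cA⟩ := RegStrategy.cons hS hA h₁ (h₂.mono (Nat.sub_le k 1))
  have hρ' : ∀ v ∈ U, v ∉ S → ρ v ≠ k := fun v hv hvS => by
    by_cases hvA : v ∈ A
    · rw [e₃ v hvA hvS]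
      omega
    · have := h₂.le v ⟨hv, hvA⟩
      rw [(e₂ v ⟨hv, hvA⟩).2]
      omega
  -- Outside `S` there is no full reset and the top value already bounds all priorities, so it stays
  -- unchanged until `S` is entered.
  let I : V → ℕ → Prop := fun v x => v ∈ U ∧
    if v ∈ S then I₁ v x else Even x ∧ ∀ w ∈ D, G.priority w ≤ x
  have hstart : ∀ v ∈ U, ∀ x, Even x → (∀ w ∈ D, G.priority w ≤ x) → I v x := by
    intro v hv x hx hxD
    refine ⟨hv, ?_⟩
    split_ifs with hvS
    · exact hI₁' v hvS x hx fun w hw => hxD w (hUD (hS.2.1 hw))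
    · exact ⟨hx, hxD⟩
  refine ⟨f, ρ, I, hf, ⟨fun v x hI => ?_, fun v x u hI hs => ?_, fun v x hI hρ => ?_⟩, hstart⟩
  · obtain ⟨hv, hI⟩ := hI
    split_ifs at hI with hvS
    · exact even_max_of_le (hI₁.even v x hI) hd hcd
    · exact even_max hI.1 hd
  · obtain ⟨hv, hI⟩ := hI
    split_ifs at hI with hvS
    · have hu := cS v u hvS hs
      refine ⟨hs.target, ?_⟩
      rw [if_pos hu, (e₁ v hvS).2]
      exact hI₁.step v x u hI (hs.restrict hvS hu (e₁ v hvS).1)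
    · rw [if_neg (hρ' v hv hvS), max_eq_left (hI.2 v (hUD hv))]
      exact hstart u hs.target x hI.1 hI.2
  · obtain ⟨hv, hI⟩ := hI
    split_ifs at hI with hvS
    · exact hI₁.safe v x hI ((e₁ v hvS).2 ▸ hρ)
    · exact absurd hρ (hρ' v hv hvS)

mutual
theorem IsAttrDecomp.exists_regStrategy {G : ParityGame V} : ∀ (H : AttrDecomp V) (d : ℕ)
    (U : Set V) (k : ℕ), G.IsAttrDecomp .steven d U H → H.strahler ≤ k →
    ∃ f ρ I, G.RegStrategy k U f ρ ∧ G.IsInvariant k d U f ρ I ∧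
      ∀ v ∈ U, ∀ x, Even x → (∀ w ∈ U, G.priority w ≤ x) → I v x
  | .mk A parts, d, U, k, h, hk => by
    rw [IsAttrDecomp] at h
    obtain ⟨hd, hU, hA, -, hparts⟩ := h
    rw [AttrDecomp.strahler, AttrDecomp.tree, OrderedTree.strahler] at hk
    obtain ⟨h1, hle, hcount⟩ := strahlerOfChildren_le hk (one_le_of_mem_strahlerList _)
    -- The priorities are bounded over all of `U`, so that the top value `d` left by a reset in the
    -- attractor is an admissible start.
    obtain ⟨f, ρ, I, hf, hI, hI'⟩ := (IsAttrParts.exists_regStrategy parts d (U \ A) k hparts hle).2 U h1 hd 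
      Set.sdiff_subset hU hcount
    exact RegStrategy.attract h1 hd hU hA hf hI hI'
theorem IsAttrParts.exists_regStrategy {G : ParityGame V} : ∀ (parts : AttrParts V) (d : ℕ)
    (U : Set V) (k : ℕ), G.IsAttrParts .steven d U parts →
    (∀ x ∈ strahlerList parts.trees, x ≤ k) →
    (∃ f ρ, G.RegStrategy k U f ρ) ∧
    ∀ D : Set V, 1 ≤ k → Even d → U ⊆ D → (∀ v ∈ D, G.priority v ≤ d) →
      (strahlerList parts.trees).count k ≤ 1 →
      ∃ f ρ I, G.RegStrategy k U f ρ ∧ G.IsInvariant k d U f ρ I ∧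
        ∀ v ∈ U, ∀ x, Even x → (∀ w ∈ D, G.priority w ≤ x) → I v x
  | .nil, d, U, k, h, hle => by
    rw [IsAttrParts] at h
    subst h
    have hs : G.RegStrategy k ∅ id fun _ => 0 :=
      ⟨fun v hv => hv.elim, fun v hv => hv.elim, fun v r hp => (hp.step 0).source.elim⟩
    exact ⟨⟨_, _, hs⟩, fun D _ _ _ _ _ => ⟨_, _, fun _ _ => False, hs,
      ⟨fun _ _ h => h.elim, fun _ _ _ h => h.elim, fun _ _ h => h.elim⟩, fun v hv => hv.elim⟩⟩
  | .cons S H A rest, d, U, k, h, hle => by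
    rw [IsAttrParts] at h
    obtain ⟨hS, -, hH, hA, hrest⟩ := h
    rw [AttrParts.trees, strahlerList] at hle ⊢
    rw [List.forall_mem_cons] at hle
    obtain ⟨hleH, hleR⟩ := hle
    have ihH := fun l => IsAttrDecomp.exists_regStrategy (G := G) H (d - 2) S l hH
    have ihR := fun l => IsAttrParts.exists_regStrategy (G := G) rest d (U \ A) l hrest
    refine ⟨?_, fun D hk hd hUD hD hcount => ?_⟩
    · obtain ⟨f₁, ρ₁, -, h₁, -⟩ := ihH k hleH
      obtain ⟨f₂, ρ₂, h₂⟩ := (ihR k hleR).1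
      obtain ⟨f, ρ, hf, -⟩ := RegStrategy.cons hS hA h₁ h₂
      exact ⟨f, ρ, hf⟩
    · by_cases hHk : H.tree.strahler = k
      · obtain ⟨f₁, ρ₁, I₁, h₁, hI₁, hI₁'⟩ := ihH k hleH
        have hnot : k ∉ strahlerList rest.trees := fun hmem => by
          have := List.count_pos_iff.2 hmem
          rw [hHk, List.count_cons_self] at hcount
          omega
        have hlt : ∀ x ∈ strahlerList rest.trees, x ≤ k - 1 := fun x hx => by
          have h1 := hleR x hx
          have h2 : x ≠ k := fun h => hnot (h ▸ hx)
          omega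
        obtain ⟨f₂, ρ₂, h₂⟩ := (ihR (k - 1) hlt).1
        exact IsInvariant.cons_eq hk hd (Nat.sub_le d 2) hUD hS hA h₁ hI₁ hI₁' h₂
      · obtain ⟨f₁, ρ₁, -, h₁, -⟩ := ihH (k - 1) (by
          have : H.tree.strahler ≤ k := hleH
          change H.tree.strahler ≤ k - 1
          omega)
        obtain ⟨f₂, ρ₂, I₂, h₂, hI₂, hI₂'⟩ := (ihR k hleR).2 D hk hd
          (Set.sdiff_subset.trans hUD) hD (by rwa [List.count_cons_of_ne hHk] at hcount)
        exact IsInvariant.cons_lt hk hd (fun v hv => hD v (hUD hv)) hS hA h₁ h₂ hI₂ hI₂'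
end

/-! ### Transfer to the register game -/

/-- The registers as a function on `ℕ`. -/
def _root_.StrahlerGames.Registers.ext {k d : ℕ} (r : Registers k d) (j : ℕ) : ℕ :=
  if h : j < k then r.val ⟨j, h⟩ else 0

theorem _root_.StrahlerGames.Registers.ext_reset {k d : ℕ} (r : Registers k d) (m : ℕ)
    (hm : m ≤ d) (i : Fin (k + 1)) {j : ℕ} (hj : j < k) :
    (r.reset m hm i).ext j = regUpdate r.ext m i j := by
  simp [Registers.ext, Registers.reset, regUpdate, hj]

theorem _root_.StrahlerGames.Registers.resetRank_eq {k d : ℕ} (r : Registers k d) (m : ℕ)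
    (i : Fin (k + 1)) : r.resetRank m i = regRank r.ext m i := by
  induction i using Fin.cases with
  | zero => simp [Registers.resetRank, regRank]
  | succ j => simp [Registers.resetRank, regRank, Registers.ext]

/-- The vertex of a state of the register game. -/
def _root_.StrahlerGames.RegState.vertex {k d : ℕ} : RegState V k d → V
  | .pair v _ => v
  | .triple v _ _ => v

/-- Steven's move in the register game when he moves by `f` and resets the registers given
by `ρ`. -/
noncomputable def nextState [Finite V] (G : ParityGame V) (k : ℕ) (f : V → V) (ρ : V → ℕ) :
    RegState V k G.evenBound → RegState V k G.evenBound
  -- The cap at `k` only makes the function total; a `RegStrategy` has `ρ v ≤ k` on its domain.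
  | .pair v r =>
    .triple v (r.reset (G.priority v) (G.priority_le_evenBound v)
      ⟨min (ρ v) k, Nat.lt_succ_of_le (min_le_right _ _)⟩)
      ⟨r.resetRank (G.priority v) ⟨min (ρ v) k, Nat.lt_succ_of_le (min_le_right _ _)⟩,
        r.resetRank_mem (G.priority v) _⟩
  | .triple v r _ => .pair (f v) r

/-- The strategy in the register game in which Steven moves by `nextState` over `D`. -/
def liftStrategy [Finite V] (G : ParityGame V) (k : ℕ) (D : Set V) (f : V → V) (ρ : V → ℕ)
    (s s' : RegState V k G.evenBound) : Prop :=
  G.RegMove k s s' ∧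
    (s.vertex ∈ D → (G.regGame k).owner s = .steven → s' = G.nextState k f ρ s)

/-- The states over `D` at which the invariant `I` holds. -/
def liftInvariant [Finite V] (G : ParityGame V) (k : ℕ) (D : Set V) (f : V → V)
    (I : V → ℕ → Prop) : Set (RegState V k G.evenBound) :=
  {s | s.vertex ∈ D ∧ match s with
    | .pair v r => I v (r.ext (k - 1))
    -- At a triple the registers are already updated, so the invariant is required at the possible
    -- next vertices.
    | .triple v r p => (p : ℕ) ≠ 2 * k + 1 ∧ ∀ u, G.Step D f v u → I u (r.ext (k - 1))}

theorem ParityWins.exists_lt_of_periodic {p : ℕ → ℕ} {n : ℕ} (hn : 0 < n)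
    (h : ParityWins fun t => p (t % n)) : ∃ i < n, Even (p i) ∧ ∀ j < n, p j ≤ p i := by
  obtain ⟨e, he, hf, N, hN⟩ := h
  obtain ⟨t, -, ht⟩ := hf 0
  dsimp only at ht
  refine ⟨t % n, Nat.mod_lt _ hn, by rwa [ht], fun j hj => ?_⟩
  have := hN (j + n * N) (by nlinarith)
  simp only [Nat.add_mul_mod_self_left, Nat.mod_eq_of_lt hj] at this
  rwa [ht]

/-- Pairs and triples alternate; the triples carry the ranks of a register play, and the rank `1` of
the pairs never exceeds these. -/
theorem RegStrategy.wins_regGame_of_pair [Finite V] {G : ParityGame V} {k : ℕ} {D : Set V}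
    {f : V → V} {ρ : V → ℕ} (hf : G.RegStrategy k D f ρ) {s : ℕ → RegState V k G.evenBound}
    (hD : ∀ t, (s t).vertex ∈ D) (hs : ∀ t, G.liftStrategy k D f ρ (s t) (s (t + 1)))
    (h0 : ∃ v r, s 0 = .pair v r) : ParityWins fun t => (G.regGame k).priority (s t) := by
  have hnext : ∀ t v r, s t = .pair v r → s (t + 1) = G.nextState k f ρ (.pair v r) := by
    intro t v r ht
    have h1 := (hs t).2 (hD t)
    rw [ht] at h1
    exact h1 rfl
  have hpair : ∀ t, ∃ v r, s (2 * t) = .pair v r := by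
    intro t
    induction t with
    | zero => exact h0
    | succ t ih =>
      obtain ⟨v, r, hvr⟩ := ih
      have h2 := (hs (2 * t + 1)).1
      rw [hnext _ _ _ hvr, nextState] at h2
      rw [show 2 * (t + 1) = 2 * t + 1 + 1 by ring]
      generalize s (2 * t + 1 + 1) = s' at h2
      cases h2
      exact ⟨_, _, rfl⟩
  choose v r hvr using hpair
  have hodd : ∀ t, s (2 * t + 1) = G.nextState k f ρ (.pair (v t) (r t)) := fun t =>
    hnext _ _ _ (hvr t)
  have hvD : ∀ t, v t ∈ D := fun t => by
    have := hD (2 * t)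
    rwa [hvr] at this
  have hρ : ∀ t, min (ρ (v t)) k = ρ (v t) := fun t => min_eq_left (hf.le _ (hvD t))
  have hmove : ∀ t, G.edge (v t) (v (t + 1)) ∧ r (t + 1) =
      (r t).reset (G.priority (v t)) (G.priority_le_evenBound (v t))
        ⟨min (ρ (v t)) k, Nat.lt_succ_of_le (min_le_right _ _)⟩ := by
    intro t
    have h2 := (hs (2 * t + 1)).1
    rw [hodd t, nextState, show 2 * t + 1 + 1 = 2 * (t + 1) by ring, hvr (t + 1)] at h2
    generalize hv' : v (t + 1) = v' at h2
    generalize hr' : r (t + 1) = r' at h2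
    cases h2 with
    | move _ _ _ _ he => exact ⟨he, rfl⟩
  have hplay : G.IsRegPlay k D f ρ v (fun t => (r t).ext) :=
    { step := fun t => ⟨hvD t, hvD (t + 1), (hmove t).1, fun ho => by
        have h2 := (hs (2 * t + 1)).2 (hD _)
        rw [hodd t, show 2 * t + 1 + 1 = 2 * (t + 1) by ring, hvr (t + 1)] at h2
        have h3 := h2 ho
        simp only [nextState, RegState.pair.injEq] at h3
        exact h3.1⟩
      update := fun t j hj => by
        rw [(hmove t).2, Registers.ext_reset _ _ _ _ hj]
        simp only [hρ t] }
  have hprio : ∀ t, (G.regGame k).priority (s (2 * t + 1)) =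
      regRank (r t).ext (G.priority (v t)) (ρ (v t)) := fun t => by
    rw [hodd t]
    simp only [nextState, regGame, Registers.resetRank_eq, hρ t]
  obtain ⟨e, he, hinf, N, hN⟩ := hf.wins v _ hplay
  refine ⟨e, he, fun M => ?_, 2 * N, fun t ht => ?_⟩
  · obtain ⟨t, ht, hte⟩ := hinf M
    exact ⟨2 * t + 1, by omega, (hprio t).trans hte⟩
  · obtain ⟨i, rfl | rfl⟩ : ∃ i, t = 2 * i ∨ t = 2 * i + 1 := ⟨t / 2, by omega⟩
    · dsimp only
      rw [hvr i]
      exact (one_le_regRank _ _ _).trans (hN i (by omega))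
    · dsimp only
      rw [hprio i]
      exact hN i (by omega)

theorem RegStrategy.wins_regGame [Finite V] {G : ParityGame V} {k : ℕ} {D : Set V}
    {f : V → V} {ρ : V → ℕ} (hf : G.RegStrategy k D f ρ) {s : ℕ → RegState V k G.evenBound}
    (hD : ∀ t, (s t).vertex ∈ D) (hs : ∀ t, G.liftStrategy k D f ρ (s t) (s (t + 1))) :
    ParityWins fun t => (G.regGame k).priority (s t) := by
  cases h0 : s 0 with
  | pair v r => exact hf.wins_regGame_of_pair hD hs ⟨v, r, h0⟩
  | triple v r p =>
    refine ParityWins.of_shift 1 (hf.wins_regGame_of_pair (s := fun t => s (t + 1))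
      (fun t => hD _) (fun t => hs _) ?_)
    have h1 := (hs 0).1
    rw [h0] at h1
    generalize s (0 + 1) = s' at h1
    cases h1
    exact ⟨_, _, rfl⟩

/-- The states satisfying the lifted invariant cannot be left and omit the rank `2 * k + 1`; their
cycles are good because Steven wins the periodic plays. -/
theorem RegStrategy.hasDefensiveStrategy [Finite V] {G : ParityGame V} {k d : ℕ} {D : Set V}
    {f : V → V} {ρ : V → ℕ} {I : V → ℕ → Prop} (hk : 1 ≤ k)
    (hclosed : ∀ v ∈ D, G.owner v ≠ .steven → ∀ u, G.edge v u → u ∈ D)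
    (hf : G.RegStrategy k D f ρ) (hI : G.IsInvariant k d D f ρ I)
    (hstart : ∀ v ∈ D, ∀ x, Even x → (∀ w ∈ D, G.priority w ≤ x) → I v x) :
    G.HasDefensiveStrategy k D := by
  refine ⟨G.liftInvariant k D f I, G.liftStrategy k D f ρ, ⟨⟨?_, ?_, ?_⟩, ?_, ?_⟩, ?_, ?_⟩
  · exact fun s s' h => ⟨Set.mem_univ _, Set.mem_univ _, h.1⟩
  · intro s _ ho
    by_cases hs : s.vertex ∈ D
    · refine ⟨G.nextState k f ρ s, ?_, fun _ _ => rfl⟩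
      cases s with
      | pair v r => exact .reset v r _
      | triple v r p => exact .move v _ r p (hf.own v hs ho).2
    · obtain ⟨s', hs'⟩ := (G.regGame k).exists_edge s
      exact ⟨s', hs', fun h => absurd h hs⟩
  · exact fun s _ ho s' _ he => ⟨he, fun _ h => absurd h ho⟩
  · rintro s ⟨hsD, hsI⟩ s' ⟨hmove, hnext⟩
    cases hmove with
    | reset v r i =>
      have hv : v ∈ D := hsD
      have hρ : min (ρ v) k = ρ v := min_eq_left (hf.le v hv)
      rw [hnext hsD rfl]
      refine ⟨hv, ?_, fun u hu => ?_⟩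
      · have := hI.regRank_le hk (hf.le v hv) hsI
        simp only [Registers.resetRank_eq, hρ]
        omega
      · rw [Registers.ext_reset _ _ _ _ (by omega)]
        simp only [hρ]
        rw [regUpdate_top hk (hf.le v hv)]
        exact hI.step v _ u hsI hu
    | move v u r p he =>
      have hv : v ∈ D := hsD
      have hu : u ∈ D ∧ (G.owner v = .steven → u = f v) := by
        by_cases ho : G.owner v = .steven
        · have h := hnext hsD ho
          simp only [nextState, RegState.pair.injEq] at h
          exact ⟨h.1 ▸ (hf.own v hv ho).1, fun _ => h.1⟩
        · exact ⟨hclosed v hv ho u he, fun h => absurd h ho⟩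
      exact ⟨hu.1, hsI.2 u ⟨hv, hu.1, he, hu.2⟩⟩
  · intro n c hn hc hcΩ hcσ
    refine ParityWins.exists_lt_of_periodic (p := fun i => (G.regGame k).priority (c i)) hn
      (hf.wins_regGame (s := fun t => c (t % n)) (fun t => (hcΩ _ (Nat.mod_lt _ hn)).1)
        fun t => ?_)
    have hlt := Nat.mod_lt t hn
    have hsucc : c ((t + 1) % n) = c (t % n + 1) := by
      rw [Nat.add_mod]
      rcases (Nat.succ_le_of_lt hlt).lt_or_eq with h | h
      · rw [Nat.mod_eq_of_lt (show 1 < n by omega), Nat.mod_eq_of_lt h]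
      · rw [Nat.add_mod_mod, show t % n + 1 = n from h, Nat.mod_self, hc]
    rw [hsucc]
    exact hcσ _ hlt
  · rintro (⟨v, r⟩ | ⟨v, r, p⟩) ⟨-, hs⟩
    · change 1 ≠ 2 * k + 1
      omega
    · exact hs.1
  · intro v hv r hr
    have h := hr ⟨k - 1, by omega⟩ (Nat.sub_add_cancel hk)
    refine ⟨hv, ?_⟩
    have hext : r.ext (k - 1) = r.val ⟨k - 1, by omega⟩ := dif_pos _
    change I v (r.ext (k - 1))
    rw [hext]
    exact hstart v hv _ h.1 h.2

theorem IsAttrDecomp.hasDefensiveStrategy [Finite V] {G : ParityGame V} {d : ℕ} {D : Set V}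
    {H : AttrDecomp V} (hH : G.IsAttrDecomp .steven d D H)
    (hclosed : ∀ v ∈ D, G.owner v ≠ .steven → ∀ u, G.edge v u → u ∈ D) :
    G.HasDefensiveStrategy H.strahler D := by
  obtain ⟨f, ρ, I, hf, hI, hstart⟩ := hH.exists_regStrategy H d D H.strahler le_rfl
  exact hf.hasDefensiveStrategy H.tree.one_le_strahler hclosed hI hstart

/-- Closure under Audrey's moves passes to unions, so the union of all dominions need not be shown
to be a dominion, nor non-empty. -/
theorem mem_largestDominion_of_edge {G : ParityGame V} {v u : V}
    (hv : v ∈ G.largestDominion .steven) (ho : G.owner v ≠ .steven) (he : G.edge v u) :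
    u ∈ G.largestDominion .steven := by
  obtain ⟨D, hD, hvD⟩ := hv
  obtain ⟨-, σ, hσ, hst, -⟩ := id hD
  exact ⟨D, hD, hst v hvD u (hσ.opp v (Set.mem_univ v) ho u (Set.mem_univ u) he)⟩

theorem lehtinenNumber_le_minStrahler [Finite V] (G : ParityGame V) :
    G.lehtinenNumber ≤ G.minStrahler .steven (G.largestDominion .steven) := by
  refine le_sInf ?_
  rintro _ ⟨d, H, hH, rfl⟩
  exact sInf_le ⟨H.strahler, H.tree.one_le_strahler, hH.hasDefensiveStrategy
    fun v hv ho u he => mem_largestDominion_of_edge hv ho he, rfl⟩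

end ParityGame

end StrahlerGames

theorem mainTheorem3 {V : Type*} [Finite V] (G : StrahlerGames.ParityGame V) :
    G.lehtinenNumber ≤ G.strahlerNumber ∧
    ∀ (D : Set V) (d : ℕ) (H : StrahlerGames.AttrDecomp V),
      G.IsTrapForOpponent .steven Set.univ D → G.IsAttrDecomp .steven d D H →
      G.HasDefensiveStrategy H.strahler D :=
  ⟨(G.lehtinenNumber_le_minStrahler).trans (le_max_left _ _), fun _ _ _ hD hH =>
    hH.hasDefensiveStrategy fun _ hv ho u he => hD.mem_of_edge hv ho (Set.mem_univ u) he⟩
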